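/- Let $\mathcal F$ be a class of probability densities with respect to a common reference measure $\mu$ on a measurable space, let $f_0\in\mathcal F$, and let $X_1,X_2,\dots$ be i.i.d. with law $f_0\,\mathrm d\mu$. For $f\in\mathcal F$ put $$\chi^2(f,f_0)=\Big\|\frac{f}{f_0}-1\Big\|^2_{L_2(f_0\mathrm d\mu)}\in[0,\infty],\qquad \ell_n(f)=\sum_{i=1}^n\log f(X_i)\quad(\log 0=-\infty).$$ Assume: (A1) $\chi^2(f,f_0)\in(0,\infty)$ for every $f\in\mathcal F\setminus\{f_0\}$; (A2) the score set $$\mathcal S=\{s_f: f\in\mathcal F\setminus\{f_0\}\},\qquad s_f=\frac{f/f_0-1}{\chi(f,f_0)},$$ where $\chi(f,f_0)$ is the square root of $\chi^2(f,f_0)$ and $s_f$ is set to $0$ on the $f_0\,\mathrm d\mu$-null set $\{f_0=0\}$, is $f_0\,\mathrm d\mu$-Donsker and admits an $f_0\,\mathrm d\mu$-square-integrable envelope. Here, with $P=f_0\,\mathrm d\mu$, "$P$-Donsker" means that the functions in $\mathcal S$ are measurable and $P$-square-integrable and that the empirical process $\mathbb G_n(s)=\sqrt n\,\big(\frac1n\sum_{i=1}^n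 s(x_i)-\int s\,\mathrm dP\big)$, $s\in\mathcal S$, built from the coordinate projections $x_i$ of the infinite product space with measure $P^{\mathbb N}$, takes values in $\ell^\infty(\mathcal S)$ and converges weakly there, in the sense of outer expectations of bounded continuous functions, to a tight Borel probability measure. An envelope is a real function $F$ with $|s(x)|\le F(x)$ for all $s\in\mathcal S$ and all $x$. Let $(c_n)$ be an arbitrary sequence of nonnegative, possibly random, numbers with $c_n=O_{\mathbb P}(1)$, and let $$\mathcal F_n=\{f\in\mathcal F:\ \ell_n(f)\ge \ell_n(f_0)-c_n\}.$$ Then $$\sup_{f\in\mathcal F_n} n\,\chi^2(f,f_0)=O_{\mathbb P}(1).$$ Here, for $[0,\infty]$-valued $Y_n$ (not necessarily measurable), $Y_n=O_{\mathbb P}(1)$ means that for every $\varepsilon>0$ there is a finite $M$ such that the outer probability of $\{Y_n>M\}$ is at most $\varepsilon$ for all sufficiently large $n$. -/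

import Mathlib

open MeasureTheory ProbabilityTheory Filter Topology
open scoped ENNReal NNReal BoundedContinuousFunction

noncomputable section

/-! ### Densities, chi-square divergence and log-likelihood -/

/-- `f` is a probability density with respect to `μ`. -/
structure IsDensity {𝓧 : Type*} [MeasurableSpace 𝓧] (μ : Measure 𝓧) (f : 𝓧 → ℝ) : Prop where
  measurable : Measurable f
  nonneg : ∀ x, 0 ≤ f x
  lintegral_eq_one : ∫⁻ x, ENNReal.ofReal (f x) ∂μ = 1

/-- The measure `f dμ`. -/
def densityMeasure {𝓧 : Type*} [MeasurableSpace 𝓧] (μ : Measure 𝓧) (f : 𝓧 → ℝ) : Measure 𝓧 :=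
  μ.withDensity fun x => ENNReal.ofReal (f x)

/-- The chi-square divergence `χ²(f, f₀) = ‖f / f₀ - 1‖²` in `L₂(f₀ dμ)`, with values in `[0, ∞]`.
The value of the quotient on the `f₀ dμ`-null set `{f₀ = 0}` is irrelevant. -/
def chiSq {𝓧 : Type*} [MeasurableSpace 𝓧] (μ : Measure 𝓧) (f f₀ : 𝓧 → ℝ) : ℝ≥0∞ :=
  eLpNorm (fun x => f x / f₀ x - 1) 2 (densityMeasure μ f₀) ^ 2

/-- `χ(f, f₀)`, the square root of the chi-square divergence (used only where the latter is
finite). -/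
def chi {𝓧 : Type*} [MeasurableSpace 𝓧] (μ : Measure 𝓧) (f f₀ : 𝓧 → ℝ) : ℝ :=
  √(chiSq μ f f₀).toReal

/-- The log-likelihood `ℓₙ(f) = ∑ log f(xᵢ)` over the first `n` points of the sequence `x`, in
`[-∞, ∞]`, with `log 0 = -∞`. -/
def logLik {𝓧 : Type*} (n : ℕ) (x : ℕ → 𝓧) (f : 𝓧 → ℝ) : EReal :=
  ∑ i ∈ Finset.range n, ENNReal.log (ENNReal.ofReal (f (x i)))

/-- The approximate maximum likelihood set `{f ∈ 𝓕 : ℓₙ(f) ≥ ℓₙ(f₀) - c}`. -/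
def approxMLESet {𝓧 : Type*} (𝓕 : Set (𝓧 → ℝ)) (f₀ : 𝓧 → ℝ) (n : ℕ) (x : ℕ → 𝓧) (c : ℝ) :
    Set (𝓧 → ℝ) :=
  {f ∈ 𝓕 | logLik n x f₀ - (c : EReal) ≤ logLik n x f}

/-! ### Scores -/

open Classical in
/-- The normalized score `s_f = (f / f₀ - 1) / χ(f, f₀)`. It is defined where `f₀ > 0`, and is given
the value `0` on the `f₀ dμ`-null set `{f₀ = 0}`. -/
def score {𝓧 : Type*} [MeasurableSpace 𝓧] (μ : Measure 𝓧) (f₀ f : 𝓧 → ℝ) : 𝓧 → ℝ :=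
  fun x => if f₀ x = 0 then 0 else (f x / f₀ x - 1) / chi μ f f₀

/-- The score set `{s_f : f ∈ 𝓕 \ {f₀}}`. -/
def scoreSet {𝓧 : Type*} [MeasurableSpace 𝓧] (μ : Measure 𝓧) (𝓕 : Set (𝓧 → ℝ)) (f₀ : 𝓧 → ℝ) :
    Set (𝓧 → ℝ) :=
  score μ f₀ '' (𝓕 \ {f₀})

/-- The class `𝓢` has an envelope that is square-integrable with respect to `P`. -/
def HasSquareIntegrableEnvelope {𝓧 : Type*} [MeasurableSpace 𝓧] (P : Measure 𝓧)
    (𝓢 : Set (𝓧 → ℝ)) : Prop :=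
  ∃ F : 𝓧 → ℝ, MemLp F 2 P ∧ ∀ s ∈ 𝓢, ∀ x, |s x| ≤ F x

/-! ### Donsker classes -/

/-- The Banach space `ℓ^∞(ι)` of bounded real functions on `ι` with the supremum norm. -/
abbrev LInfty (ι : Type*) : Type _ := lp (fun _ : ι => ℝ) ∞

instance instMeasurableSpaceLInfty (ι : Type*) : MeasurableSpace (LInfty ι) := borel _

instance instBorelSpaceLInfty (ι : Type*) : BorelSpace (LInfty ι) := ⟨rfl⟩

/-- The outer expectation `E^* h = inf {E U : U ≥ h, U measurable and integrable}` of a bounded,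
not necessarily measurable function `h`. -/
def outerExpectation {Ω : Type*} [MeasurableSpace Ω] (Q : Measure Ω) (h : Ω → ℝ) : ℝ :=
  sInf {a : ℝ | ∃ U : Ω → ℝ, Measurable U ∧ Integrable U Q ∧ (∀ ω, h ω ≤ U ω) ∧ a = ∫ ω, U ω ∂Q}

/-- The empirical process `𝔾ₙ(s) = √n (n⁻¹ ∑ s(xᵢ) - P s)` of the first `n` points of `x`. -/
def empiricalProcess {𝓧 : Type*} [MeasurableSpace 𝓧] (P : Measure 𝓧) (n : ℕ) (x : ℕ → 𝓧)
    (s : 𝓧 → ℝ) : ℝ :=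
  √(n : ℝ) * ((n : ℝ)⁻¹ * ∑ i ∈ Finset.range n, s (x i) - ∫ y, s y ∂P)

/-- `𝓢` is a `P`-Donsker class: a class of measurable, `P`-square-integrable functions such that the
empirical process of the coordinate projections of `(𝓧^ℕ, P^ℕ)` has its sample paths in `ℓ^∞(𝓢)`
and converges weakly there, in the sense of outer expectations, to a tight Borel probability
measure `ν`. (The limit is then necessarily Gaussian, by the multivariate central limit theorem.) -/
def IsDonsker {𝓧 : Type*} [MeasurableSpace 𝓧] (P : Measure 𝓧) (𝓢 : Set (𝓧 → ℝ)) : Prop :=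
  (∀ s ∈ 𝓢, Measurable s ∧ MemLp s 2 P) ∧
  ∃ G : ℕ → (ℕ → 𝓧) → LInfty 𝓢,
    (∀ (n : ℕ) (x : ℕ → 𝓧) (s : 𝓢), G n x s = empiricalProcess P n x s) ∧
    ∃ ν : Measure (LInfty 𝓢), IsProbabilityMeasure ν ∧ IsTightMeasureSet {ν} ∧
      ∀ h : LInfty 𝓢 →ᵇ ℝ,
        Tendsto (fun n => outerExpectation (Measure.infinitePi fun _ : ℕ => P) fun x => h (G n x))
          atTop (𝓝 (∫ z, h z ∂ν))

/-! ### Boundedness in probability -/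

/-- `Yₙ = O_P(1)` for `[0, ∞]`-valued `Yₙ`: for every `ε > 0` there is a finite `M` with
`Pr(Yₙ > M) ≤ ε` for all large `n`. The `Yₙ` need not be measurable; `Pr` of a set that is not
measurable is its outer probability. -/
def IsBoundedInProbability {Ω : Type*} [MeasurableSpace Ω] (Pr : Measure Ω)
    (Y : ℕ → Ω → ℝ≥0∞) : Prop :=
  ∀ ε : ℝ≥0∞, 0 < ε → ∃ M : ℝ≥0, ∀ᶠ n in atTop, Pr {ω | (M : ℝ≥0∞) < Y n ω} ≤ ε

end

/-!
Every approximate maximum likelihood estimator `f ≠ f₀` satisfies, with `s = s_f`, `χ = χ(f, f₀)`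
and `f / f₀ = 1 + χ s` at the sample points, `-c ≤ ∑ log (1 + χ s(xᵢ))`. The elementary inequality
`log (1 + t) ≤ t - (t⁻)² / 2` and `P s ≤ 0` give, with `D = √n χ`,
`-c ≤ D 𝔾ₙ(s) - D² Pₙ(s⁻)² / 2 ≤ D M - D² b² / 2`, where `M` bounds the empirical process and
`b > 0` is a uniform lower bound for the empirical means `Pₙ s⁻`. Hence `D² = n χ²` is bounded in
terms of `M`, `b` and `c` (`natCast_mul_chi_sq_le`). Weak convergence of `𝔾ₙ` provides `M`
(`IsDonsker.exists_abs_empiricalProcess_le`), and the point is to find `b`.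

Since `P s ≤ 0`, `P s² = 1` and the scores have a square-integrable envelope, `P s⁻` is bounded away
from zero over the class (`exists_le_integral_negPart`). The lower bound is transferred to `Pₙ s⁻`,
uniformly over a possibly uncountable class and with outer probabilities only, without proving that
the class of negative parts is Glivenko–Cantelli:

* Tightness of the limit of `𝔾ₙ` splits the class into finitely many cells on which `𝔾ₙ(s - t)` is
  small with large probability, and the central limit theorem for the single function `s - t` turns
  this into smallness of its variance. So the class is totally bounded in `L₁(P)`
  (`IsDonsker.exists_finite_net`).
* For `s` in the cell of `t` one has `s⁻ ≥ -1_{t < 0} s`, which is linear in `s`, and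
  `-P (1_{t < 0} s)` is close to `P t⁻`. It remains to have a uniform law of large numbers for
  `1_A s` with `A` fixed (`IsDonsker.exists_abs_empiricalMean_indicator_sub_le`). It follows from
  the one for `s` by redrawing the sample points outside `A` from the conditional law on `Aᶜ` and
  averaging over the new draws. A measurable function dominating `|Pₙ s - P s|` for all `s` at once
  (`IsDonsker.exists_dominating`) makes this legitimate in the absence of measurability of suprema.
-/

section

variable {𝓧 : Type*} [MeasurableSpace 𝓧]

/-! ### Tightness of the empirical process of a Donsker class -/

theorem exists_measurable_of_outerExpectation_lt {Ω : Type*} [MeasurableSpace Ω] (Q : Measure Ω)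
    [IsProbabilityMeasure Q] {h : Ω → ℝ} {C a : ℝ} (hC : ∀ ω, h ω ≤ C)
    (ha : outerExpectation Q h < a) :
    ∃ U : Ω → ℝ, Measurable U ∧ Integrable U Q ∧ (∀ ω, h ω ≤ U ω) ∧ ∫ ω, U ω ∂Q < a := by
  obtain ⟨b, ⟨U, hU1, hU2, hU3, rfl⟩, hb⟩ := exists_lt_of_csInf_lt
    (⟨_, fun _ => C, measurable_const, integrable_const _, hC, rfl⟩ :
      {a : ℝ | ∃ U : Ω → ℝ, Measurable U ∧ Integrable U Q ∧ (∀ ω, h ω ≤ U ω) ∧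
        a = ∫ ω, U ω ∂Q}.Nonempty) ha
  exact ⟨U, hU1, hU2, hU3, hb⟩

/-- A version of Markov's inequality for outer expectations. -/
theorem exists_measurableSet_of_outerExpectation_lt {Ω : Type*} [MeasurableSpace Ω] (Q : Measure Ω)
    [IsProbabilityMeasure Q] {h : Ω → ℝ} {C a : ℝ} (h0 : ∀ ω, 0 ≤ h ω) (hC : ∀ ω, h ω ≤ C)
    (ha : outerExpectation Q h < a) :
    ∃ B : Set Ω, MeasurableSet B ∧ Q B ≤ ENNReal.ofReal a ∧ ∀ ω ∉ B, h ω < 1 := by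
  obtain ⟨U, hU1, hU2, hU3, hU4⟩ := exists_measurable_of_outerExpectation_lt Q hC ha
  refine ⟨{ω | 1 ≤ U ω}, measurableSet_le measurable_const hU1, ?_, fun ω hω => ?_⟩
  · have h1 := mul_meas_ge_le_integral_of_nonneg
      (ae_of_all _ fun ω => (h0 ω).trans (hU3 ω)) hU2 1
    rw [one_mul] at h1
    rw [← ENNReal.ofReal_toReal (measure_ne_top Q {ω | 1 ≤ U ω})]
    exact ENNReal.ofReal_le_ofReal (h1.trans hU4.le)
  · exact (hU3 ω).trans_lt (not_le.1 hω)

/-- Tightness of the limit: up to a small probability, the empirical process of a Donsker class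
stays in the union of finitely many small balls of `ℓ^∞`. -/
theorem IsDonsker.exists_finset_cover {P : Measure 𝓧} [IsProbabilityMeasure P] {𝓢 : Set (𝓧 → ℝ)}
    (hS : IsDonsker P 𝓢) {ε η : ℝ} (hε : 0 < ε) (hη : 0 < η) :
    ∃ Z : Finset (LInfty 𝓢), ∀ᶠ n : ℕ in atTop, ∃ B : Set (ℕ → 𝓧), MeasurableSet B ∧
      Measure.infinitePi (fun _ : ℕ => P) B ≤ ENNReal.ofReal η ∧
      ∀ x ∉ B, ∃ z ∈ Z, ∀ s : 𝓢, |(empiricalProcess P n x s - z s)| < ε := by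
  obtain ⟨-, G, hG, ν, hν, hT, hW⟩ := hS
  obtain ⟨K, hK, hKν⟩ := isTightMeasureSet_iff_exists_isCompact_measure_compl_le.1 hT
    (ENNReal.ofReal (η / 2)) (by simpa using hη)
  have hKν := hKν ν rfl
  obtain ⟨t, -, htf, htK⟩ := hK.finite_cover_balls (half_pos hε)
  classical
  let Z : Finset (LInfty 𝓢) := insert 0 htf.toFinset
  have hZ : (Z : Set (LInfty 𝓢)).Nonempty := ⟨0, by simp [Z]⟩
  -- a continuous function that vanishes on `K` and equals `1` far away from `Z`
  let h : LInfty 𝓢 →ᵇ ℝ := BoundedContinuousFunction.ofNormedAddCommGroup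
    (fun z => max 0 (min 1 (2 * Metric.infDist z Z / ε - 1)))
    (by have := Metric.continuous_infDist_pt (Z : Set (LInfty 𝓢)); fun_prop) 1
    (fun z => by
      rw [Real.norm_eq_abs, abs_of_nonneg (le_max_left _ _)]
      exact max_le zero_le_one (min_le_left _ _))
  have h0 : ∀ z, 0 ≤ h z := fun z => le_max_left _ _
  have h1 : ∀ z, h z ≤ 1 := fun z => max_le zero_le_one (min_le_left _ _)
  have hhK : ∀ z ∈ K, h z = 0 := by
    intro z hz
    obtain ⟨y, hy, hyz⟩ := Set.mem_iUnion₂.1 (htK hz)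
    have h2 : Metric.infDist z Z < ε / 2 :=
      (Metric.infDist_lt_iff hZ).2 ⟨y, by simp [Z, hy], hyz⟩
    have h3 : 2 * Metric.infDist z Z / ε - 1 ≤ 0 := by
      rw [sub_nonpos, div_le_one hε]; linarith
    exact max_eq_left ((min_le_right _ _).trans h3)
  have hint : ∫ z, h z ∂ν ≤ η / 2 := by
    have h2 : ∫ z, h z ∂ν ≤ ∫ z, Kᶜ.indicator (fun _ => (1 : ℝ)) z ∂ν := by
      refine integral_mono (h.integrable ν)
        ((integrable_const _).indicator hK.isClosed.measurableSet.compl) fun z => ?_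
      by_cases hz : z ∈ K
      · simp [hz, hhK z hz]
      · simpa [hz] using h1 z
    refine h2.trans ?_
    rw [integral_indicator_const _ hK.isClosed.measurableSet.compl, smul_eq_mul, mul_one]
    exact ENNReal.toReal_le_of_le_ofReal (by positivity) hKν
  refine ⟨Z, ?_⟩
  filter_upwards [(hW h).eventually_lt_const (hint.trans_lt (half_lt_self hη))] with n hn
  obtain ⟨B, hB, hBη, hB1⟩ := exists_measurableSet_of_outerExpectation_lt _
    (fun x => h0 _) (fun x => h1 (G n x)) hn
  refine ⟨B, hB, hBη, fun x hx => ?_⟩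
  have h2 : Metric.infDist (G n x) Z < ε := by
    by_contra! hcon
    have h3 : 1 ≤ 2 * Metric.infDist (G n x) Z / ε - 1 := by
      have : 2 ≤ 2 * Metric.infDist (G n x) Z / ε := by rw [le_div_iff₀ hε]; linarith
      linarith
    have h4 : (1 : ℝ) ≤ h (G n x) := le_max_of_le_right (le_min le_rfl h3)
    exact absurd (hB1 x hx) (not_lt.2 h4)
  obtain ⟨z, hz, hzd⟩ := (Metric.infDist_lt_iff hZ).1 h2
  refine ⟨z, hz, fun s => ?_⟩
  rw [dist_eq_norm] at hzd
  rw [← hG n x s]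
  exact (lp.norm_apply_le_norm ENNReal.top_ne_zero (G n x - z) s).trans_lt hzd

theorem IsDonsker.exists_abs_empiricalProcess_le {P : Measure 𝓧} [IsProbabilityMeasure P]
    {𝓢 : Set (𝓧 → ℝ)} (hS : IsDonsker P 𝓢) {η : ℝ} (hη : 0 < η) :
    ∃ M : ℝ, 0 ≤ M ∧ ∀ᶠ n : ℕ in atTop, ∃ B : Set (ℕ → 𝓧), MeasurableSet B ∧
      Measure.infinitePi (fun _ : ℕ => P) B ≤ ENNReal.ofReal η ∧
      ∀ x ∉ B, ∀ s ∈ 𝓢, |(empiricalProcess P n x s)| ≤ M := by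
  obtain ⟨Z, hZ⟩ := hS.exists_finset_cover one_pos hη
  refine ⟨∑ z ∈ Z, ‖z‖ + 1, by positivity, ?_⟩
  filter_upwards [hZ] with n ⟨B, hB, hBη, hBZ⟩
  refine ⟨B, hB, hBη, fun x hx s hs => ?_⟩
  obtain ⟨z, hz, hzs⟩ := hBZ x hx
  have h1 := hzs ⟨s, hs⟩
  have h2 : |z ⟨s, hs⟩| ≤ ‖z‖ := lp.norm_apply_le_norm ENNReal.top_ne_zero z ⟨s, hs⟩
  have h3 : ‖z‖ ≤ ∑ z ∈ Z, ‖z‖ :=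
    Finset.single_le_sum (f := fun z => ‖z‖) (fun _ _ => norm_nonneg _) hz
  have h4 := abs_sub_abs_le_abs_sub (empiricalProcess P n x s) (z ⟨s, hs⟩)
  linarith

/-! ### Total boundedness in `L₁` -/

/-- By the central limit theorem, `𝔾ₙ(u)` cannot be small with large probability for all large `n`
unless `u` has small variance. -/
theorem one_sub_exp_variance_le {P : Measure 𝓧} [IsProbabilityMeasure P] {u : 𝓧 → ℝ}
    (hu : Measurable u) (hu2 : MemLp u 2 P) {ε η : ℝ} (hε : 0 ≤ ε) (hη : 0 ≤ η)
    (h : ∀ᶠ n : ℕ in atTop, ∃ B : Set (ℕ → 𝓧), MeasurableSet B ∧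
      Measure.infinitePi (fun _ : ℕ => P) B ≤ ENNReal.ofReal η ∧
      ∀ x ∉ B, |(empiricalProcess P n x u)| ≤ ε) :
    1 - Real.exp (-Var[u; P] / 2) ≤ ε + 2 * η := by
  set Q := Measure.infinitePi (fun _ : ℕ => P)
  have hmp : ∀ i : ℕ, MeasurePreserving (fun x : ℕ → 𝓧 => x i) Q P := fun i =>
    measurePreserving_eval_infinitePi (fun _ : ℕ => P) i
  have hmap : ∀ i : ℕ, Q.map (fun x : ℕ → 𝓧 => u (x i)) = P.map u := fun i => by
    rw [← (hmp i).map_eq, Measure.map_map hu (hmp i).measurable]; rfl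
  have hI : ∀ i, IdentDistrib (fun x : ℕ → 𝓧 => u (x i)) u Q P := fun i =>
    ⟨(hu.comp (hmp i).measurable).aemeasurable, hu.aemeasurable, hmap i⟩
  -- the characteristic function of `𝔾ₙ(u)` at `1` tends to `exp (-Var u / 2)`, and is close to `1`
  have hclt := tendstoInDistribution_inv_sqrt_mul_sum_sub (P := Q)
    (X := fun i (x : ℕ → 𝓧) => u (x i))
    (P' := gaussianReal 0 Var[fun x : ℕ → 𝓧 => u (x 0); Q].toNNReal) (Y := id)
    ⟨aemeasurable_id, Measure.map_id⟩ ((hI 0).memLp_iff.2 hu2)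
    (iIndepFun_infinitePi (P := fun _ : ℕ => P) (X := fun _ => u) (fun _ => hu))
    (fun i => (hI i).trans (hI 0).symm)
  have hch := ProbabilityMeasure.tendsto_iff_tendsto_charFun.1 hclt.tendsto 1
  have hlim : charFun (gaussianReal 0 Var[fun x : ℕ → 𝓧 => u (x 0); Q].toNNReal) 1 =
      (Real.exp (-Var[u; P] / 2) : ℂ) := by
    rw [charFun_gaussianReal, (hI 0).variance_eq]
    simp [Real.coe_toNNReal _ (variance_nonneg u P), neg_div]
  have hbound : ∀ᶠ n : ℕ in atTop,
      ‖charFun (Q.map fun x : ℕ → 𝓧 => (√(n : ℝ))⁻¹ *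
        (∑ k ∈ Finset.range n, u (x k) - n * Q[fun x : ℕ → 𝓧 => u (x 0)])) 1 - 1‖
        ≤ ε + 2 * η := by
    filter_upwards [h, eventually_ge_atTop 1] with n ⟨B, hB, hBη, hBu⟩ hn
    set W : (ℕ → 𝓧) → ℝ := fun x => (√(n : ℝ))⁻¹ *
        (∑ k ∈ Finset.range n, u (x k) - n * Q[fun x : ℕ → 𝓧 => u (x 0)]) with hW
    have hWm : Measurable W := by fun_prop
    have hWe : ∀ x, W x = empiricalProcess P n x u := fun x => by
      have hn0 : (0 : ℝ) < n := by exact_mod_cast hn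
      have hs : √(n : ℝ) ≠ 0 := (Real.sqrt_pos.2 hn0).ne'
      have hss : √(n : ℝ) * √(n : ℝ) = n := Real.mul_self_sqrt hn0.le
      simp only [hW, empiricalProcess, (hI 0).integral_eq]
      rw [inv_mul_eq_iff_eq_mul₀ hs, ← mul_assoc, hss]
      field_simp
    rw [charFun_apply_real, integral_map hWm.aemeasurable (by fun_prop)]
    have hint : Integrable (fun x => Complex.exp ((1 : ℝ) * (W x : ℂ) * Complex.I)) Q := by
      refine Integrable.of_bound (by fun_prop) 1 (ae_of_all _ fun x => ?_)
      simp [Complex.norm_exp]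
    have h1 : ∫ x, Complex.exp ((1 : ℝ) * (W x : ℂ) * Complex.I) ∂Q - 1 =
        ∫ x, (Complex.exp ((1 : ℝ) * (W x : ℂ) * Complex.I) - 1) ∂Q := by
      rw [integral_sub hint (integrable_const _)]; simp
    rw [h1]
    refine (norm_integral_le_integral_norm _).trans ?_
    have h2 : ∀ x, ‖Complex.exp ((1 : ℝ) * (W x : ℂ) * Complex.I) - 1‖ ≤
        ε + B.indicator (fun _ => (2 : ℝ)) x := by
      intro x
      by_cases hx : x ∈ B
      · have : ‖Complex.exp ((1 : ℝ) * (W x : ℂ) * Complex.I)‖ = 1 := by simp [Complex.norm_exp]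
        have := norm_sub_le (Complex.exp ((1 : ℝ) * (W x : ℂ) * Complex.I)) 1
        simp only [hx, Set.indicator_of_mem]
        simp only [norm_one] at this
        linarith
      · simp only [hx, not_false_eq_true, Set.indicator_of_notMem, add_zero]
        have h3 := Real.norm_exp_I_mul_ofReal_sub_one_le (x := W x)
        have h4 := hBu x hx
        rw [← hWe] at h4
        rw [Complex.ofReal_one, one_mul, mul_comm]
        exact h3.trans h4
    refine (integral_mono (hint.sub (integrable_const _)).norm
      ((integrable_const _).add ((integrable_const _).indicator hB)) h2).trans ?_
    rw [integral_add' (integrable_const _) ((integrable_const _).indicator hB),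
      integral_indicator_const _ hB]
    have : Q.real B ≤ η := ENNReal.toReal_le_of_le_ofReal hη hBη
    simp only [integral_const, probReal_univ, smul_eq_mul]
    linarith
  have hle := le_of_tendsto (hch.sub_const 1).norm hbound
  have h5 : ‖charFun (gaussianReal 0 Var[fun x : ℕ → 𝓧 => u (x 0); Q].toNNReal) 1 - 1‖ =
      1 - Real.exp (-Var[u; P] / 2) := by
    rw [hlim, ← Complex.ofReal_one, ← Complex.ofReal_sub, Complex.norm_real, Real.norm_eq_abs,
      abs_sub_comm, abs_of_nonneg]
    have := variance_nonneg u P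
    rw [sub_nonneg, Real.exp_le_one_iff]
    linarith
  rw [← h5]
  simpa using hle

theorem integral_abs_le_add_sqrt_variance {P : Measure 𝓧} [IsProbabilityMeasure P] {u : 𝓧 → ℝ}
    (hu : MemLp u 2 P) : ∫ x, |u x| ∂P ≤ |∫ x, u x ∂P| + √Var[u; P] := by
  set m := ∫ x, u x ∂P with hm
  have hv : MemLp (fun x => u x - m) 2 P := hu.sub (memLp_const m)
  have h1 : 0 ≤ Var[fun x => |u x - m|; P] := variance_nonneg _ _
  rw [variance_eq_sub (X := fun x => |u x - m|) hv.abs] at h1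
  have h2 : Var[u; P] = ∫ x, ((fun x => |u x - m|) ^ 2) x ∂P := by
    rw [variance_eq_integral hu.aemeasurable]
    exact integral_congr_ae (ae_of_all _ fun x => by simp [hm])
  have h3 : ∫ x, |u x - m| ∂P ≤ √Var[u; P] := by
    apply Real.le_sqrt_of_sq_le
    rw [h2]; linarith
  have h4 : ∫ x, |u x| ∂P ≤ ∫ x, (|u x - m| + |m|) ∂P := by
    refine integral_mono (hu.integrable (by norm_num)).abs
      ((hv.integrable (by norm_num)).abs.add (integrable_const _)) fun x => ?_
    have := abs_add_le (u x - m) m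
    simpa using this
  rw [integral_add (hv.integrable (by norm_num)).abs (integrable_const _)] at h4
  simp only [integral_const, probReal_univ, smul_eq_mul, one_mul] at h4
  linarith

theorem empiricalProcess_sub {P : Measure 𝓧} {s t : 𝓧 → ℝ} (hs : Integrable s P)
    (ht : Integrable t P) (n : ℕ) (x : ℕ → 𝓧) :
    empiricalProcess P n x (s - t) =
      empiricalProcess P n x s - empiricalProcess P n x t := by
  simp only [empiricalProcess, Pi.sub_apply, Finset.sum_sub_distrib, integral_sub hs ht]
  ring

/-- A Donsker class with bounded means is totally bounded in `L₁(P)`. -/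
theorem IsDonsker.exists_finite_net {P : Measure 𝓧} [IsProbabilityMeasure P] {𝓢 : Set (𝓧 → ℝ)}
    (hS : IsDonsker P 𝓢) {C : ℝ} (hC : ∀ s ∈ 𝓢, |∫ y, s y ∂P| ≤ C) {δ : ℝ} (hδ : 0 < δ) :
    ∃ T : Set (𝓧 → ℝ), T.Finite ∧ T ⊆ 𝓢 ∧ ∀ s ∈ 𝓢, ∃ t ∈ T, ∫ y, |s y - t y| ∂P ≤ δ := by
  set r := 1 - Real.exp (-(δ / 2) ^ 2 / 2) with hr
  have hr0 : 0 < r := by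
    rw [hr, sub_pos, Real.exp_lt_one_iff]
    have := sq_pos_of_pos (half_pos hδ)
    linarith
  set ε := r / 6 with hε
  have hε0 : 0 < ε := by positivity
  obtain ⟨Z, hZ⟩ := hS.exists_finset_cover hε0 hε0
  -- two functions with close images under `Φ` are close at every center `z ∈ Z`, and in mean
  let Φ : 𝓢 → (Z → ℝ) × ℝ := fun s => (fun z => (z : LInfty 𝓢) s, ∫ y, (s : 𝓧 → ℝ) y ∂P)
  have hΦ : TotallyBounded (Set.range Φ) := by
    refine (isCompact_closedBall (0 : (Z → ℝ) × ℝ) (max (∑ z ∈ Z, ‖z‖) C)).totallyBounded.subset ?_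
    rintro _ ⟨s, rfl⟩
    rw [mem_closedBall_zero_iff, Prod.norm_def]
    refine max_le_max ?_ (hC s s.2)
    refine (pi_norm_le_iff_of_nonneg (Finset.sum_nonneg fun _ _ => norm_nonneg _)).2 fun z => ?_
    exact (lp.norm_apply_le_norm ENNReal.top_ne_zero (z : LInfty 𝓢) s).trans
      (Finset.single_le_sum (f := fun z => ‖z‖) (fun _ _ => norm_nonneg _) z.2)
  obtain ⟨T, hTsub, hTfin, hT⟩ := Metric.finite_approx_of_totallyBounded hΦ (min ε (δ / 2))
    (lt_min hε0 (half_pos hδ))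
  choose g hg using fun p : T => hTsub p.2
  have := hTfin.to_subtype
  refine ⟨Set.range fun p : T => (g p : 𝓧 → ℝ), Set.finite_range _, ?_, fun s hs => ?_⟩
  · rintro _ ⟨p, rfl⟩
    exact (g p).2
  obtain ⟨p, hp, hsp⟩ := Set.mem_iUnion₂.1 (hT ⟨⟨s, hs⟩, rfl⟩)
  refine ⟨_, ⟨⟨p, hp⟩, rfl⟩, ?_⟩
  set t := g ⟨p, hp⟩
  change ∫ y, |s y - (t : 𝓧 → ℝ) y| ∂P ≤ δ
  have hp' : Φ t = p := hg ⟨p, hp⟩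
  rw [← hp', Metric.mem_ball, Prod.dist_eq, max_lt_iff] at hsp
  obtain ⟨hsm, hs2⟩ := hS.1 s hs
  obtain ⟨htm, ht2⟩ := hS.1 t t.2
  have hs1 : Integrable s P := hs2.integrable (by norm_num)
  have ht1 : Integrable (t : 𝓧 → ℝ) P := ht2.integrable (by norm_num)
  have hmean : |∫ y, (s y - (t : 𝓧 → ℝ) y) ∂P| ≤ δ / 2 := by
    rw [integral_sub hs1 ht1]
    exact (hsp.2.trans_le (min_le_right _ _)).le
  have hvar : Var[fun y => s y - (t : 𝓧 → ℝ) y; P] ≤ (δ / 2) ^ 2 := by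
    have h1 : 1 - Real.exp (-Var[fun y => s y - (t : 𝓧 → ℝ) y; P] / 2) ≤ 3 * ε + 2 * ε := by
      refine one_sub_exp_variance_le (hsm.sub htm) (hs2.sub ht2) (by positivity) hε0.le ?_
      filter_upwards [hZ] with n ⟨B, hB, hBε, hBZ⟩
      refine ⟨B, hB, hBε, fun x hx => ?_⟩
      obtain ⟨z, hz, hzx⟩ := hBZ x hx
      rw [empiricalProcess_sub hs1 ht1]
      have h2 := abs_lt.1 (hzx ⟨s, hs⟩)
      have h3 := abs_lt.1 (hzx t)
      have h4 : |z ⟨s, hs⟩ - z t| < ε :=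
        ((dist_le_pi_dist (fun z : Z => (z : LInfty 𝓢) ⟨s, hs⟩) (fun z : Z => (z : LInfty 𝓢) t)
          ⟨z, hz⟩).trans_lt hsp.1).trans_le (min_le_left _ _)
      have h5 := abs_lt.1 h4
      rw [abs_le]
      constructor <;> linarith [h2.1, h2.2, h3.1, h3.2, h5.1, h5.2]
    have h2 : Real.exp (-(δ / 2) ^ 2 / 2) ≤
        Real.exp (-Var[fun y => s y - (t : 𝓧 → ℝ) y; P] / 2) := by linarith
    have := Real.exp_le_exp.1 h2
    linarith
  refine (integral_abs_le_add_sqrt_variance (hs2.sub ht2)).trans ?_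
  have h3 : √Var[fun y => s y - (t : 𝓧 → ℝ) y; P] ≤ δ / 2 :=
    (Real.sqrt_le_left (by positivity)).2 hvar
  have h4 := add_le_add hmean h3
  rw [add_halves] at h4
  exact h4

/-! ### The uniform law of large numbers -/

/-- The empirical mean `n⁻¹ ∑ s(xᵢ)` of `s` over the first `n` points of `x`. -/
noncomputable def empiricalMean {𝓧 : Type*} (n : ℕ) (x : ℕ → 𝓧) (s : 𝓧 → ℝ) : ℝ :=
  (n : ℝ)⁻¹ * ∑ i ∈ Finset.range n, s (x i)

theorem empiricalMean_mono {𝓧 : Type*} {s t : 𝓧 → ℝ} (h : ∀ y, s y ≤ t y) (n : ℕ) (x : ℕ → 𝓧) :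
    empiricalMean n x s ≤ empiricalMean n x t :=
  mul_le_mul_of_nonneg_left (Finset.sum_le_sum fun _ _ => h _) (by positivity)

theorem abs_empiricalMean_le {𝓧 : Type*} (s : 𝓧 → ℝ) (n : ℕ) (x : ℕ → 𝓧) :
    |empiricalMean n x s| ≤ empiricalMean n x (fun y => |s y|) := by
  rw [empiricalMean, abs_mul, abs_of_nonneg (by positivity)]
  exact mul_le_mul_of_nonneg_left (Finset.abs_sum_le_sum_abs _ _) (by positivity)

theorem measurePreserving_coordinate (P : Measure 𝓧) [IsProbabilityMeasure P] (i : ℕ) :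
    MeasurePreserving (fun x : ℕ → 𝓧 => x i) (Measure.infinitePi fun _ : ℕ => P) P :=
  measurePreserving_eval_infinitePi (fun _ : ℕ => P) i

theorem integrable_empiricalMean {P : Measure 𝓧} [IsProbabilityMeasure P] {s : 𝓧 → ℝ}
    (hs : Integrable s P) (n : ℕ) :
    Integrable (fun x => empiricalMean n x s) (Measure.infinitePi fun _ : ℕ => P) :=
  (integrable_finsetSum _ fun i _ =>
    (measurePreserving_coordinate P i).integrable_comp_of_integrable hs).const_mul _

theorem integral_empiricalMean {P : Measure 𝓧} [IsProbabilityMeasure P] {s : 𝓧 → ℝ}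
    (hs : Integrable s P) {n : ℕ} (hn : n ≠ 0) :
    ∫ x, empiricalMean n x s ∂(Measure.infinitePi fun _ : ℕ => P) = ∫ y, s y ∂P := by
  have h : ∀ i : ℕ, ∫ x : ℕ → 𝓧, s (x i) ∂(Measure.infinitePi fun _ : ℕ => P) = ∫ y, s y ∂P := by
    intro i
    have hm := measurePreserving_coordinate P i
    rw [← integral_map (f := s) hm.measurable.aemeasurable
      (by rw [hm.map_eq]; exact hs.aestronglyMeasurable), hm.map_eq]
  have hi : ∀ i : ℕ, Integrable (fun x : ℕ → 𝓧 => s (x i)) (Measure.infinitePi fun _ : ℕ => P) :=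
    fun i => (measurePreserving_coordinate P i).integrable_comp_of_integrable hs
  simp only [empiricalMean]
  rw [integral_const_mul, integral_finsetSum _ fun i _ => hi i]
  simp [h, hn]

/-- The Glivenko–Cantelli property of a Donsker class with a square-integrable envelope, in the
mean: `sup |Pₙ s - P s|` is dominated by a measurable function of small expectation. -/
theorem IsDonsker.exists_dominating {P : Measure 𝓧} [IsProbabilityMeasure P] {𝓢 : Set (𝓧 → ℝ)}
    (hS : IsDonsker P 𝓢) {F : 𝓧 → ℝ} (hF : MemLp F 2 P) (hSF : ∀ s ∈ 𝓢, ∀ x, |s x| ≤ F x)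
    {η : ℝ} (hη : 0 < η) :
    ∀ᶠ n : ℕ in atTop, ∃ U : (ℕ → 𝓧) → ℝ≥0∞, AEMeasurable U (Measure.infinitePi fun _ : ℕ => P) ∧
      ∫⁻ x, U x ∂(Measure.infinitePi fun _ : ℕ => P) ≤ ENNReal.ofReal η ∧
      ∀ x, ∀ s ∈ 𝓢, ‖empiricalMean n x s - ∫ y, s y ∂P‖ₑ ≤ U x := by
  set Q := Measure.infinitePi fun _ : ℕ => P
  set V := ∫ y, F y ^ 2 ∂P with hV
  have hV0 : 0 ≤ V := integral_nonneg fun _ => sq_nonneg _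
  set a := η / (6 * (V + 1)) with ha
  have ha0 : 0 < a := by positivity
  have haV : 2 * a * V ≤ η / 3 := by
    rw [ha, show 2 * (η / (6 * (V + 1))) * V = η / 3 * (V / (V + 1)) by field_simp; ring]
    exact mul_le_of_le_one_right (by positivity) (by rw [div_le_one (by positivity)]; linarith)
  have hF2 : Integrable (fun y => F y ^ 2) P := hF.integrable_sq
  -- the choice of `a` makes `a F²` small in mean, and the constant `1 / (4 * a)` only matters on
  -- an exceptional set, whose probability can be made small compared with `a`
  have hFa : ∀ y, F y ≤ a * F y ^ 2 + 1 / (4 * a) := fun y => by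
    have h1 : a * F y ^ 2 + 1 / (4 * a) - F y = (2 * a * F y - 1) ^ 2 / (4 * a) := by
      field_simp; ring
    have h2 : 0 ≤ (2 * a * F y - 1) ^ 2 / (4 * a) := by positivity
    linarith
  obtain ⟨M, hM0, hM⟩ := hS.exists_abs_empiricalProcess_le (η := 2 * a * (η / 3)) (by positivity)
  have hMn : ∀ᶠ n : ℕ in atTop, M / √(n : ℝ) ≤ η / 3 :=
    ((Real.tendsto_sqrt_atTop.comp
      tendsto_natCast_atTop_atTop).const_div_atTop M).eventually_le_const
        (by positivity : (0 : ℝ) < η / 3)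
  filter_upwards [hM, hMn, eventually_ge_atTop 1] with n ⟨B, hB, hBη, hBM⟩ hn hn1
  have hn0 : (0 : ℝ) < n := by exact_mod_cast hn1
  -- off `B` the first summand dominates; on `B` the envelope does, through the other two
  let u : (ℕ → 𝓧) → ℝ := fun x => M / √(n : ℝ) + a * (empiricalMean n x (fun y => F y ^ 2) + V) +
    B.indicator (fun _ => 1 / (2 * a)) x
  have hi1 : Integrable (fun x => empiricalMean n x (fun y => F y ^ 2)) Q :=
    integrable_empiricalMean hF2 n
  have hi2 : Integrable (B.indicator (fun _ : ℕ → 𝓧 => 1 / (2 * a))) Q :=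
    (integrable_const _).indicator hB
  have hi4 : Integrable (fun x => empiricalMean n x (fun y => F y ^ 2) + V) Q :=
    hi1.add (integrable_const _)
  have hi3 : Integrable
      (fun x => M / √(n : ℝ) + a * (empiricalMean n x (fun y => F y ^ 2) + V)) Q :=
    (integrable_const _).add (hi4.const_mul a)
  have hu : Integrable u Q := hi3.add hi2
  have hE0 : ∀ x, 0 ≤ empiricalMean n x (fun y => F y ^ 2) := fun x =>
    mul_nonneg (by positivity) (Finset.sum_nonneg fun _ _ => sq_nonneg _)
  have hu0 : ∀ x, 0 ≤ u x := fun x => by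
    have h1 := hE0 x
    have h2 : 0 ≤ B.indicator (fun _ : ℕ → 𝓧 => 1 / (2 * a)) x :=
      Set.indicator_nonneg (fun _ _ => by positivity) x
    positivity
  refine ⟨fun x => ENNReal.ofReal (u x), hu.aemeasurable.ennreal_ofReal, ?_, fun x s hs => ?_⟩
  · rw [← ofReal_integral_eq_lintegral_ofReal hu (ae_of_all _ hu0)]
    refine ENNReal.ofReal_le_ofReal ?_
    have h1 : ∫ x, u x ∂Q = M / √(n : ℝ) + a * (V + V) + Q.real B * (1 / (2 * a)) := by
      simp only [u]
      rw [integral_add hi3 hi2, integral_add (integrable_const _)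
        (hi4.const_mul a), integral_const_mul,
        integral_add hi1 (integrable_const _), integral_empiricalMean hF2 (by omega),
        integral_indicator_const _ hB]
      simp [← hV]
    have h2 : Q.real B ≤ 2 * a * (η / 3) := ENNReal.toReal_le_of_le_ofReal (by positivity) hBη
    have h3 : Q.real B * (1 / (2 * a)) ≤ η / 3 := by
      rw [mul_one_div, div_le_iff₀ (by positivity)]; linarith
    rw [h1]; linarith
  · rw [Real.enorm_eq_ofReal_abs]
    refine ENNReal.ofReal_le_ofReal ?_
    have h1 := hE0 x
    by_cases hx : x ∈ B
    · have h2 : |empiricalMean n x s| ≤ a * empiricalMean n x (fun y => F y ^ 2) + 1 / (4 * a) := by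
        refine (abs_empiricalMean_le s n x).trans ((empiricalMean_mono
          (fun y => (hSF s hs y).trans (hFa y)) n x).trans_eq ?_)
        simp only [empiricalMean, Finset.sum_add_distrib, ← Finset.mul_sum]
        simp only [Finset.sum_const, Finset.card_range, nsmul_eq_mul]
        field_simp
      have h3 : |∫ y, s y ∂P| ≤ a * V + 1 / (4 * a) := by
        have hi : Integrable (fun y => a * F y ^ 2 + 1 / (4 * a)) P :=
          (hF2.const_mul a).add (integrable_const _)
        have h4 : |∫ y, s y ∂P| ≤ ∫ y, (a * F y ^ 2 + 1 / (4 * a)) ∂P :=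
          (Real.norm_eq_abs _).symm.trans_le (norm_integral_le_of_norm_le hi
            (ae_of_all _ fun y => (hSF s hs y).trans (hFa y)))
        rw [integral_add (hF2.const_mul a) (integrable_const _), integral_const_mul] at h4
        simpa using h4
      have h5 := abs_sub (empiricalMean n x s) (∫ y, s y ∂P)
      have h6 : 0 ≤ M / √(n : ℝ) := by positivity
      have h7 : 1 / (2 * a) = 1 / (4 * a) + 1 / (4 * a) := by field_simp; norm_num
      simp only [u, Set.indicator_of_mem hx]
      linarith
    · have h2 := hBM x hx s hs
      have h3 : empiricalProcess P n x s = √(n : ℝ) * (empiricalMean n x s - ∫ y, s y ∂P) := rfl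
      rw [h3, abs_mul, abs_of_nonneg (Real.sqrt_nonneg _), mul_comm,
        ← le_div_iff₀ (Real.sqrt_pos.2 hn0)] at h2
      simp only [u, Set.indicator_of_notMem hx, add_zero]
      have : 0 ≤ a * (empiricalMean n x (fun y => F y ^ 2) + V) := by positivity
      linarith

/-! ### Restriction of the uniform law of large numbers to a set -/

/-- Coordinatewise pushforward of a product of two infinite product measures. -/
theorem map_prod_infinitePi {𝓨 𝓩 : Type*} [MeasurableSpace 𝓨] [MeasurableSpace 𝓩]
    (P : Measure 𝓧) [IsProbabilityMeasure P] (ρ : Measure 𝓨) [IsProbabilityMeasure ρ]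
    {φ : 𝓧 × 𝓨 → 𝓩} (hφ : Measurable φ) :
    ((Measure.infinitePi fun _ : ℕ => P).prod (Measure.infinitePi fun _ : ℕ => ρ)).map
      (fun p (i : ℕ) => φ (p.1 i, p.2 i)) = Measure.infinitePi fun _ : ℕ => (P.prod ρ).map φ := by
  have := Measure.isProbabilityMeasure_map (μ := P.prod ρ) hφ.aemeasurable
  refine Measure.eq_infinitePi _ fun I t ht => ?_
  have hm : MeasurableSet ((I : Set ℕ).pi t) := .pi I.countable_toSet fun _ _ => ht _
  have hz : Measurable (fun (p : (ℕ → 𝓧) × (ℕ → 𝓨)) (i : ℕ) => φ (p.1 i, p.2 i)) := by fun_prop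
  have hX : ∀ i, Measurable fun a : 𝓧 => ρ {b | φ (a, b) ∈ t i} := fun i =>
    measurable_measure_prodMk_left (hφ (ht i))
  rw [Measure.map_apply hz hm, Measure.prod_apply (hz hm)]
  have h1 : ∀ x : ℕ → 𝓧, (Measure.infinitePi fun _ : ℕ => ρ)
      (Prod.mk x ⁻¹' ((fun (p : (ℕ → 𝓧) × (ℕ → 𝓨)) (i : ℕ) => φ (p.1 i, p.2 i)) ⁻¹'
        (I : Set ℕ).pi t)) = ∏ i ∈ I, ρ {b | φ (x i, b) ∈ t i} := fun x => by
    rw [← Measure.infinitePi_pi (fun _ : ℕ => ρ) (t := fun i => {b | φ (x i, b) ∈ t i})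
      fun i _ => (hφ.comp measurable_prodMk_left) (ht i)]
    rfl
  simp_rw [h1]
  rw [lintegral_prod_eq_prod_lintegral_of_indepFun I (fun i (x : ℕ → 𝓧) => ρ {b | φ (x i, b) ∈ t i})
    (iIndepFun_infinitePi (P := fun _ : ℕ => P) hX) fun i => (hX i).comp (measurable_pi_apply i)]
  refine Finset.prod_congr rfl fun i _ => ?_
  rw [(measurePreserving_coordinate P i).lintegral_comp (hX i), Measure.map_apply hφ (ht i),
    Measure.prod_apply (hφ (ht i))]
  rfl

/-- A version of the conditional distribution of `P` on the complement of `A` which is a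
probability measure also when `A` has full measure. -/
theorem exists_conditional_compl (P : Measure 𝓧) [IsProbabilityMeasure P] (A : Set 𝓧) :
    ∃ ρ : Measure 𝓧, IsProbabilityMeasure ρ ∧ (∃ c : ℝ≥0∞, c ≠ ∞ ∧ ρ ≤ c • P) ∧
      P Aᶜ • ρ = P.restrict Aᶜ := by
  by_cases h : P Aᶜ = 0
  · refine ⟨P, inferInstance, ⟨1, ENNReal.one_ne_top, by simp⟩, ?_⟩
    rw [h, zero_smul, Measure.restrict_eq_zero.2 h]
  · refine ⟨P[|Aᶜ], cond_isProbabilityMeasure h, ⟨(P Aᶜ)⁻¹, ENNReal.inv_ne_top.2 h, ?_⟩, ?_⟩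
    · rw [ProbabilityTheory.cond]
      gcongr
      exact Measure.restrict_le_self
    · rw [ProbabilityTheory.cond, smul_smul, ENNReal.mul_inv_cancel h (measure_ne_top _ _),
        one_smul]

open Classical in
/-- Keep `x` if it lies in `A`, and otherwise replace it by `y`. -/
noncomputable def resample {𝓧 : Type*} (A : Set 𝓧) (p : 𝓧 × 𝓧) : 𝓧 := if p.1 ∈ A then p.1 else p.2

theorem measurable_resample {A : Set 𝓧} (hA : MeasurableSet A) : Measurable (resample A) :=
  Measurable.ite (measurable_fst hA) measurable_fst measurable_snd

/-- Replacing a point outside `A` by an independent draw from the conditional law on `Aᶜ` does not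
change its law. -/
theorem map_resample {P ρ : Measure 𝓧} [IsProbabilityMeasure P] [IsProbabilityMeasure ρ] {A : Set 𝓧}
    (hA : MeasurableSet A) (hR : P Aᶜ • ρ = P.restrict Aᶜ) :
    (P.prod ρ).map (resample A) = P := by
  ext B hB
  rw [Measure.map_apply (measurable_resample hA) hB, Measure.prod_apply (measurable_resample hA hB)]
  have h1 : ∀ x, ρ (Prod.mk x ⁻¹' (resample A ⁻¹' B)) =
      (A ∩ B).indicator 1 x + Aᶜ.indicator (fun _ => ρ B) x := fun x => by
    by_cases hx : x ∈ A
    · by_cases hxB : x ∈ B <;> simp [resample, Set.preimage, hx, hxB]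
    · simp [resample, Set.preimage, hx]
  simp_rw [h1]
  have h2 := congrArg (fun m : Measure 𝓧 => m B) hR
  simp only [Measure.smul_apply, smul_eq_mul, Measure.restrict_apply hB] at h2
  rw [lintegral_add_left (measurable_one.indicator (hA.inter hB)),
    lintegral_indicator_one (hA.inter hB), lintegral_indicator_const hA.compl, mul_comm, h2,
    Set.inter_comm A, ← Set.sdiff_eq, measure_inter_add_sdiff _ hA]

theorem tendsto_measure_empiricalMean_indicator {P : Measure 𝓧} [IsProbabilityMeasure P] {A : Set 𝓧}
    (hA : MeasurableSet A) {ε : ℝ} (hε : 0 < ε) :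
    Tendsto (fun n : ℕ => (Measure.infinitePi fun _ : ℕ => P)
      {x | ε ≤ |empiricalMean n x (A.indicator 1) - P.real A|}) atTop (𝓝 0) := by
  set Q := Measure.infinitePi fun _ : ℕ => P
  set g : 𝓧 → ℝ := A.indicator 1 with hg
  have hgm : Measurable g := measurable_one.indicator hA
  have hgi : Integrable g P := (integrable_const (1 : ℝ)).indicator hA
  have hI : ∀ i : ℕ, IdentDistrib (fun x : ℕ → 𝓧 => g (x i)) g Q P := fun i =>
    ⟨(hgm.comp (measurable_pi_apply i)).aemeasurable, hgm.aemeasurable, by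
      rw [← (measurePreserving_coordinate P i).map_eq, Measure.map_map hgm (measurable_pi_apply i)]
      rfl⟩
  have h := strong_law_ae_real (fun i (x : ℕ → 𝓧) => g (x i)) ((hI 0).integrable_iff.2 hgi)
    (fun i j hij => (iIndepFun_infinitePi (P := fun _ : ℕ => P) (X := fun _ => g)
      fun _ => hgm).indepFun hij) fun i => (hI i).trans (hI 0).symm
  have hmean : ∫ x : ℕ → 𝓧, g (x 0) ∂Q = P.real A := by
    rw [(hI 0).integral_eq, hg, integral_indicator_one hA]
  have h2 := tendstoInMeasure_of_tendsto_ae (f := fun n x => empiricalMean n x g) (μ := Q)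
    (g := fun _ => P.real A) (fun n => (integrable_empiricalMean hgi n).aestronglyMeasurable) (by
      filter_upwards [h] with x hx
      rw [hmean] at hx
      exact hx.congr fun n => by rw [empiricalMean, div_eq_inv_mul])
  simpa only [Real.dist_eq] using tendstoInMeasure_iff_dist.1 h2 ε hε

theorem empiricalMean_resample {𝓧 : Type*} {A : Set 𝓧} (s : 𝓧 → ℝ) (n : ℕ) (x y : ℕ → 𝓧) :
    empiricalMean n (fun i => resample A (x i, y i)) s = empiricalMean n x (A.indicator s) +
      (n : ℝ)⁻¹ * ∑ i ∈ Finset.range n, Aᶜ.indicator (1 : 𝓧 → ℝ) (x i) * s (y i) := by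
  rw [empiricalMean, empiricalMean, ← mul_add, ← Finset.sum_add_distrib]
  congr 1
  refine Finset.sum_congr rfl fun i _ => ?_
  by_cases h : x i ∈ A <;> simp [resample, h]

/-- The uniform law of large numbers passes from a Donsker class `𝓢` with square-integrable envelope
to the class of restrictions `1_A s`, `s ∈ 𝓢`. If the sample points outside `A` are replaced by
independent draws from the conditional law on `Aᶜ`, then the sample still has law `P`; averaging
over these draws, with Jensen's inequality, isolates the contribution of `A`. -/
theorem IsDonsker.exists_abs_empiricalMean_indicator_sub_le {P : Measure 𝓧} [IsProbabilityMeasure P]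
    {𝓢 : Set (𝓧 → ℝ)} (hS : IsDonsker P 𝓢) {F : 𝓧 → ℝ} (hF : MemLp F 2 P)
    (hSF : ∀ s ∈ 𝓢, ∀ x, |s x| ≤ F x) {A : Set 𝓧} (hA : MeasurableSet A) {η : ℝ} (hη : 0 < η) :
    ∀ᶠ n : ℕ in atTop, ∃ B : Set (ℕ → 𝓧), Measure.infinitePi (fun _ : ℕ => P) B ≤ ENNReal.ofReal η ∧
      ∀ x ∉ B, ∀ s ∈ 𝓢, |empiricalMean n x (A.indicator s) - ∫ y, A.indicator s y ∂P| ≤ η := by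
  set Q := Measure.infinitePi fun _ : ℕ => P
  obtain ⟨ρ, hRp, ⟨c, hc, hRc⟩, hR⟩ := exists_conditional_compl P A
  set ρ' := Measure.infinitePi fun _ : ℕ => ρ
  have hFR : Integrable F ρ :=
    ((hF.integrable (by norm_num)).smul_measure hc).mono_measure hRc
  set C := ∫ y, F y ∂ρ with hC
  let z : (ℕ → 𝓧) × (ℕ → 𝓧) → ℕ → 𝓧 := fun p i => resample A (p.1 i, p.2 i)
  have hzm : Measurable z := measurable_pi_lambda _ fun i => (measurable_resample hA).comp
    (by fun_prop)
  have hz : MeasurePreserving z (Q.prod ρ') Q :=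
    ⟨hzm, by rw [map_prod_infinitePi P ρ (measurable_resample hA), map_resample hA hR]⟩
  have hgc := hS.exists_dominating hF hSF (η := η / 2 * (η / 2)) (by positivity)
  have hlln := (tendsto_measure_empiricalMean_indicator (P := P) hA.compl
    (ε := η / 2 / (|C| + 1)) (by positivity)).eventually_le_const
    (by simpa using hη : (0 : ℝ≥0∞) < ENNReal.ofReal (η / 2))
  filter_upwards [hgc, hlln, eventually_ge_atTop 1] with n ⟨U, hU, hUη, hUS⟩ hn hn1
  have hn0 : (0 : ℝ) < n := by exact_mod_cast hn1
  have hUz : AEMeasurable (fun p => U (z p)) (Q.prod ρ') := hU.comp_quasiMeasurePreserving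
    hz.quasiMeasurePreserving
  -- the dominating function of the resampled points, averaged over the fresh draws
  let V : (ℕ → 𝓧) → ℝ≥0∞ := fun x => ∫⁻ y, U (z (x, y)) ∂ρ'
  have hV : AEMeasurable V Q := hUz.lintegral_prod_right'
  have hVη : ∫⁻ x, V x ∂Q ≤ ENNReal.ofReal (η / 2 * (η / 2)) := by
    rw [← lintegral_prod _ hUz]
    refine le_trans (le_of_eq ?_) hUη
    rw [← lintegral_map' (by rw [hz.map_eq]; exact hU) hzm.aemeasurable, hz.map_eq]
  refine ⟨{x | ENNReal.ofReal (η / 2) ≤ V x} ∪ {x | η / 2 / (|C| + 1) ≤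
    |empiricalMean n x (Aᶜ.indicator 1) - P.real Aᶜ|}, ?_, fun x hx s hs => ?_⟩
  · have h0 : ENNReal.ofReal η = ENNReal.ofReal (η / 2) + ENNReal.ofReal (η / 2) := by
      rw [← ENNReal.ofReal_add (by positivity) (by positivity), add_halves]
    rw [h0]
    refine (measure_union_le _ _).trans (add_le_add ?_ hn)
    have h1 := mul_meas_ge_le_lintegral₀ hV (ENNReal.ofReal (η / 2))
    have h2 := h1.trans hVη
    rw [ENNReal.ofReal_mul (by positivity)] at h2
    exact (ENNReal.mul_le_mul_iff_right (by simpa using hη) ENNReal.ofReal_ne_top).1 h2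
  simp only [Set.mem_union, Set.mem_ofPred_eq, not_or, not_le] at hx
  obtain ⟨hsm, hs2⟩ := hS.1 s hs
  have hsP : Integrable s P := hs2.integrable (by norm_num)
  have hsR : Integrable s ρ := hFR.mono' hsm.aestronglyMeasurable (ae_of_all _ (hSF s hs))
  have hsC : |∫ y, s y ∂ρ| ≤ |C| := (Real.norm_eq_abs _).symm.trans_le
    ((norm_integral_le_of_norm_le hFR (ae_of_all _ (hSF s hs))).trans (le_abs_self _))
  have hPs : ∫ y, s y ∂P = ∫ y, A.indicator s y ∂P + P.real Aᶜ * ∫ y, s y ∂ρ := by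
    rw [integral_indicator hA, ← integral_add_compl hA hsP, ← hR, integral_smul_measure]
    rfl
  have hsW : ∀ i : ℕ, Integrable (fun y : ℕ → 𝓧 => s (y i)) ρ' := fun i =>
    (measurePreserving_coordinate ρ i).integrable_comp_of_integrable hsR
  have hsRi : ∀ i : ℕ, ∫ y : ℕ → 𝓧, s (y i) ∂ρ' = ∫ y, s y ∂ρ := fun i => by
    have hm := measurePreserving_coordinate ρ i
    rw [← integral_map (f := s) hm.measurable.aemeasurable
      (by rw [hm.map_eq]; exact hsR.aestronglyMeasurable), hm.map_eq]
  -- the resampled empirical mean, averaged over the fresh draws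
  have hav : ∫ y, (empiricalMean n (z (x, y)) s - ∫ y, s y ∂P) ∂ρ' =
      empiricalMean n x (A.indicator s) + empiricalMean n x (Aᶜ.indicator 1) * ∫ y, s y ∂ρ -
        ∫ y, s y ∂P := by
    have hi : Integrable (fun y : ℕ → 𝓧 => (n : ℝ)⁻¹ * ∑ i ∈ Finset.range n,
        Aᶜ.indicator (1 : 𝓧 → ℝ) (x i) * s (y i)) ρ' :=
      (integrable_finsetSum _ fun i _ => (hsW i).const_mul _).const_mul _
    have hi' : Integrable (fun y : ℕ → 𝓧 => empiricalMean n x (A.indicator s) +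
        (n : ℝ)⁻¹ * ∑ i ∈ Finset.range n, Aᶜ.indicator (1 : 𝓧 → ℝ) (x i) * s (y i)) ρ' :=
      (integrable_const _).add hi
    simp only [z, empiricalMean_resample]
    rw [integral_sub hi' (integrable_const _), integral_add (integrable_const _) hi,
      integral_const_mul, integral_finsetSum _ fun i _ => (hsW i).const_mul _]
    simp only [integral_const_mul, hsRi, ← Finset.sum_mul]
    simp [empiricalMean, mul_assoc]
  have hJ : |∫ y, (empiricalMean n (z (x, y)) s - ∫ y, s y ∂P) ∂ρ'| ≤ η / 2 := by
    have h1 : ‖∫ y, (empiricalMean n (z (x, y)) s - ∫ y, s y ∂P) ∂ρ'‖ₑ ≤ V x :=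
      (enorm_integral_le_lintegral_enorm _).trans (lintegral_mono fun y => hUS _ s hs)
    have h2 := h1.trans hx.1.le
    rw [Real.enorm_eq_ofReal_abs] at h2
    exact (ENNReal.ofReal_le_ofReal_iff (by positivity)).1 h2
  rw [hav, hPs] at hJ
  have hL : |(empiricalMean n x (Aᶜ.indicator 1) - P.real Aᶜ) * ∫ y, s y ∂ρ| ≤ η / 2 := by
    rw [abs_mul]
    calc _ ≤ η / 2 / (|C| + 1) * (|C| + 1) :=
          mul_le_mul hx.2.le (by linarith) (abs_nonneg _) (by positivity)
      _ = η / 2 := by field_simp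
  rw [abs_le] at hJ hL ⊢
  constructor <;> linarith [hJ.1, hJ.2, hL.1, hL.2]

/-! ### Lower bounds for negative parts -/

/-- Truncation: `F² ≤ K |F|` up to a remainder of small integral, for large `K`. -/
theorem exists_integral_sq_sub_mul_le {P : Measure 𝓧} {F : 𝓧 → ℝ} (hF : MemLp F 2 P) {ε : ℝ}
    (hε : 0 < ε) : ∃ K : ℝ, 0 < K ∧ Integrable (fun y => max (F y ^ 2 - K * |F y|) 0) P ∧
      ∫ y, max (F y ^ 2 - K * |F y|) 0 ∂P ≤ ε := by
  have hm : ∀ K : ℝ, AEStronglyMeasurable (fun y => max (F y ^ 2 - K * |F y|) 0) P := fun K =>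
    (((hF.aestronglyMeasurable.pow 2).sub (hF.aestronglyMeasurable.norm.const_mul K)).sup
      aestronglyMeasurable_const)
  have hb : ∀ K : ℝ, 0 ≤ K → ∀ y, ‖max (F y ^ 2 - K * |F y|) 0‖ ≤ F y ^ 2 := fun K hK y => by
    rw [Real.norm_eq_abs, abs_of_nonneg (le_max_right _ _)]
    exact max_le (sub_le_self _ (by positivity)) (sq_nonneg _)
  have h := tendsto_integral_of_dominated_convergence (μ := P)
    (F := fun (n : ℕ) y => max (F y ^ 2 - (n : ℝ) * |F y|) 0) (f := fun _ => 0) (fun y => F y ^ 2)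
    (fun n => hm n) hF.integrable_sq (fun n => ae_of_all _ (hb n n.cast_nonneg))
    (ae_of_all _ fun y => by
      obtain ⟨N, hN⟩ := exists_nat_ge |F y|
      refine tendsto_const_nhds.congr' ?_
      filter_upwards [eventually_ge_atTop N] with n hn
      have h1 : |F y| ≤ n := hN.trans (by exact_mod_cast hn)
      have h2 : F y ^ 2 ≤ n * |F y| := by
        rw [← sq_abs, sq]; exact mul_le_mul_of_nonneg_right h1 (abs_nonneg _)
      exact (max_eq_right (sub_nonpos.2 h2)).symm)
  rw [integral_zero] at h
  obtain ⟨n, hn, hn1⟩ := ((h.eventually_le_const hε).and (eventually_ge_atTop 1)).exists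
  exact ⟨n, by exact_mod_cast hn1,
    hF.integrable_sq.mono' (hm n) (ae_of_all _ (hb n n.cast_nonneg)), hn⟩

/-- Functions of nonpositive mean and unit second moment under a common square-integrable envelope
have negative parts of uniformly positive mean: otherwise some of them would tend to `0` in `L₁`,
and hence, because of the envelope, in `L₂`. -/
theorem exists_le_integral_negPart {P : Measure 𝓧} {F : 𝓧 → ℝ} (hF : MemLp F 2 P)
    (hF1 : Integrable F P) :
    ∃ δ : ℝ, 0 < δ ∧ ∀ s : 𝓧 → ℝ, Measurable s → (∀ x, |s x| ≤ F x) → ∫ y, s y ∂P ≤ 0 →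
      ∫ y, s y ^ 2 ∂P = 1 → δ ≤ ∫ y, max (-s y) 0 ∂P := by
  obtain ⟨K, hK, hKi, hK2⟩ := exists_integral_sq_sub_mul_le hF (ε := 1 / 2) (by norm_num)
  refine ⟨1 / (4 * K), by positivity, fun s hs hsF h0 h1 => ?_⟩
  have hsi : Integrable s P := hF1.mono' hs.aestronglyMeasurable (ae_of_all _ hsF)
  have hs2 : Integrable (fun y => s y ^ 2) P :=
    hF.integrable_sq.mono' (by fun_prop) (ae_of_all _ fun y => by
      rw [Real.norm_eq_abs, abs_of_nonneg (sq_nonneg _), ← sq_abs]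
      exact pow_le_pow_left₀ (abs_nonneg _) (hsF y) 2)
  have hneg : Integrable (fun y => max (-s y) 0) P := hsi.neg.pos_part
  have h2 : ∫ y, |s y| ∂P = ∫ y, s y ∂P + 2 * ∫ y, max (-s y) 0 ∂P := by
    rw [← integral_const_mul, ← integral_add hsi (hneg.const_mul 2)]
    refine integral_congr_ae (ae_of_all _ fun y => ?_)
    rcases le_total 0 (s y) with h | h
    · simp [abs_of_nonneg h, h]
    · simp only [abs_of_nonpos h, max_eq_left (neg_nonneg.2 h)]; ring
  -- `t² - K t` is convex, so on `[0, F]` it is at most the larger of its endpoint values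
  have h3 : ∫ y, s y ^ 2 ∂P ≤ ∫ y, (K * |s y| + max (F y ^ 2 - K * |F y|) 0) ∂P := by
    refine integral_mono hs2 ((hsi.abs.const_mul K).add hKi) fun y => ?_
    have h4 := hsF y
    have h5 : 0 ≤ |s y| := abs_nonneg _
    rw [abs_of_nonneg (h5.trans h4), ← sq_abs (s y)]
    rcases le_total |s y| K with h | h
    · have := le_max_right (F y ^ 2 - K * F y) 0
      nlinarith
    · have := le_max_left (F y ^ 2 - K * F y) 0
      nlinarith
  rw [integral_add (hsi.abs.const_mul K) hKi, integral_const_mul, h1, h2] at h3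
  rw [div_le_iff₀ (by positivity)]
  nlinarith

/-- With large probability the empirical means of the negative parts are bounded away from zero,
uniformly over the class. For `s` close to a member `t` of a finite `L₁`-net, the empirical mean of
the negative part of `s` is at least that of `-1_{t < 0} s`, which is linear in `s`. -/
theorem IsDonsker.exists_le_empiricalMean_negPart {P : Measure 𝓧} [IsProbabilityMeasure P]
    {𝓢 : Set (𝓧 → ℝ)} (hS : IsDonsker P 𝓢) {F : 𝓧 → ℝ} (hF : MemLp F 2 P)
    (hSF : ∀ s ∈ 𝓢, ∀ x, |s x| ≤ F x) (h0 : ∀ s ∈ 𝓢, ∫ y, s y ∂P ≤ 0)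
    (h1 : ∀ s ∈ 𝓢, ∫ y, s y ^ 2 ∂P = 1) :
    ∃ b : ℝ, 0 < b ∧ ∀ η : ℝ, 0 < η → ∀ᶠ n : ℕ in atTop, ∃ B : Set (ℕ → 𝓧),
      Measure.infinitePi (fun _ : ℕ => P) B ≤ ENNReal.ofReal η ∧
      ∀ x ∉ B, ∀ s ∈ 𝓢, b ≤ empiricalMean n x (fun y => max (-s y) 0) := by
  have hF1 : Integrable F P := hF.integrable (by norm_num)
  obtain ⟨δ, hδ, hδS⟩ := exists_le_integral_negPart hF hF1
  have hsi : ∀ s ∈ 𝓢, Integrable s P := fun s hs => (hS.1 s hs).2.integrable (by norm_num)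
  obtain ⟨T, hTfin, hTS, hT⟩ := hS.exists_finite_net (C := ∫ y, F y ∂P)
    (fun s hs => (Real.norm_eq_abs _).symm.trans_le
      (norm_integral_le_of_norm_le hF1 (ae_of_all _ (hSF s hs)))) (δ := δ / 4) (by positivity)
  lift T to Finset (𝓧 → ℝ) using hTfin
  refine ⟨δ / 2, by positivity, fun η hη => ?_⟩
  have hA : ∀ t ∈ T, MeasurableSet {y | t y < 0} := fun t ht =>
    measurableSet_lt (hS.1 t (hTS ht)).1 measurable_const
  set κ := min (δ / 4) (η / (T.card + 1)) with hκ
  have hκ0 : 0 < κ := lt_min (by positivity) (by positivity)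
  have hev : ∀ᶠ n : ℕ in atTop, ∀ t ∈ T, ∃ B : Set (ℕ → 𝓧),
      Measure.infinitePi (fun _ : ℕ => P) B ≤ ENNReal.ofReal κ ∧ ∀ x ∉ B, ∀ s ∈ 𝓢,
        |empiricalMean n x ({y | t y < 0}.indicator s) - ∫ y, {y | t y < 0}.indicator s y ∂P| ≤ κ :=
    (Filter.eventually_all_finset T).2 fun t ht =>
      hS.exists_abs_empiricalMean_indicator_sub_le hF hSF (hA t ht) hκ0
  filter_upwards [hev] with n hn
  choose! B hBκ hB using hn
  refine ⟨⋃ t ∈ T, B t, ?_, fun x hx s hs => ?_⟩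
  · calc _ ≤ ∑ t ∈ T, Measure.infinitePi (fun _ : ℕ => P) (B t) := measure_biUnion_finset_le _ _
      _ ≤ ∑ t ∈ T, ENNReal.ofReal κ := Finset.sum_le_sum hBκ
      _ = ENNReal.ofReal (T.card * κ) := by
        rw [Finset.sum_const, nsmul_eq_mul, ENNReal.ofReal_mul (by positivity),
          ENNReal.ofReal_natCast]
      _ ≤ ENNReal.ofReal η := by
        refine ENNReal.ofReal_le_ofReal ?_
        have h2 : κ * (T.card + 1) ≤ η :=
          (le_div_iff₀ (by positivity)).1 (min_le_right _ _)
        nlinarith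
  obtain ⟨t, ht, hst⟩ := hT s hs
  have htT : t ∈ T := ht
  have htS : t ∈ 𝓢 := hTS ht
  set A := {y | t y < 0} with hAdef
  have hx' : x ∉ B t := fun h => hx (Set.mem_biUnion htT h)
  have h2 := abs_le.1 (hB t htT x hx' s hs)
  have h3 : κ ≤ δ / 4 := min_le_left _ _
  have h4 : -empiricalMean n x (A.indicator s) ≤ empiricalMean n x (fun y => max (-s y) 0) := by
    have h5 : -empiricalMean n x (A.indicator s) =
        empiricalMean n x (fun y => -A.indicator s y) := by
      simp [empiricalMean]
    rw [h5]
    refine empiricalMean_mono (fun y => ?_) n x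
    by_cases hy : y ∈ A <;> simp [hy]
  have hd : Integrable (fun y => |s y - t y|) P := ((hsi s hs).sub (hsi t htS)).abs
  have hi : Integrable (fun y => A.indicator s y) P := (hsi s hs).indicator (hA t htT)
  have h6 : ∫ y, max (-t y) 0 ∂P ≤ ∫ y, (|s y - t y| - A.indicator s y) ∂P := by
    refine integral_mono (hsi t htS).neg.pos_part (hd.sub hi) fun y => ?_
    by_cases hy : t y < 0
    · have := neg_abs_le (s y - t y)
      simp only [A, Set.indicator_of_mem (show y ∈ {y | t y < 0} from hy)]
      rw [max_eq_left (by linarith)]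
      linarith [le_abs_self (s y - t y)]
    · simp only [A, Set.indicator_of_notMem (show y ∉ {y | t y < 0} from hy)]
      rw [max_eq_right (by linarith)]
      simp
  rw [integral_sub hd hi] at h6
  have h7 := hδS t (hS.1 t htS).1 (hSF t htS) (h0 t htS) (h1 t htS)
  linarith [h2.2]

/-! ### Densities and scores -/

theorem IsDensity.isProbabilityMeasure {μ : Measure 𝓧} {f : 𝓧 → ℝ} (hf : IsDensity μ f) :
    IsProbabilityMeasure (densityMeasure μ f) :=
  ⟨by rw [densityMeasure, withDensity_apply _ .univ, Measure.restrict_univ, hf.lintegral_eq_one]⟩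

theorem IsDensity.ae_pos {μ : Measure 𝓧} {f : 𝓧 → ℝ} (hf : IsDensity μ f) :
    ∀ᵐ x ∂densityMeasure μ f, 0 < f x := by
  rw [densityMeasure, ae_withDensity_iff hf.measurable.ennreal_ofReal]
  exact ae_of_all _ fun x hx => by simpa using hx

/-- The likelihood ratio has mean at most `1` under `f₀`. The inequality is strict when `f` charges
the set `{f₀ = 0}`. -/
theorem IsDensity.lintegral_div_le {μ : Measure 𝓧} {f f₀ : 𝓧 → ℝ} (hf : IsDensity μ f)
    (hf₀ : IsDensity μ f₀) :
    ∫⁻ x, ENNReal.ofReal (f x / f₀ x) ∂densityMeasure μ f₀ ≤ 1 := by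
  have hm : Measurable fun x => ENNReal.ofReal (f x / f₀ x) :=
    (hf.measurable.div hf₀.measurable).ennreal_ofReal
  rw [densityMeasure, lintegral_withDensity_eq_lintegral_mul _ hf₀.measurable.ennreal_ofReal hm,
    ← hf.lintegral_eq_one]
  refine lintegral_mono fun x => ?_
  rw [Pi.mul_apply, ← ENNReal.ofReal_mul (hf₀.nonneg x)]
  refine ENNReal.ofReal_le_ofReal ?_
  rcases eq_or_ne (f₀ x) 0 with h | h
  · simpa [h] using hf.nonneg x
  · rw [mul_div_cancel₀ _ h]

theorem chiSq_self {μ : Measure 𝓧} {f : 𝓧 → ℝ} (hf : IsDensity μ f) : chiSq μ f f = 0 := by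
  have h : (fun x => f x / f x - 1) =ᵐ[densityMeasure μ f] 0 := by
    filter_upwards [hf.ae_pos] with x hx
    simp [hx.ne']
  rw [chiSq, eLpNorm_congr_ae h, eLpNorm_zero, zero_pow two_ne_zero]

section Score

variable {μ : Measure 𝓧} {f f₀ : 𝓧 → ℝ}

theorem chi_pos (h0 : 0 < chiSq μ f f₀) (h1 : chiSq μ f f₀ < ∞) : 0 < chi μ f f₀ :=
  Real.sqrt_pos.2 (ENNReal.toReal_pos h0.ne' h1.ne)

theorem chi_sq : chi μ f f₀ ^ 2 = (chiSq μ f f₀).toReal :=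
  Real.sq_sqrt ENNReal.toReal_nonneg

theorem memLp_div_sub_one (hf : IsDensity μ f) (hf₀ : IsDensity μ f₀) (h : chiSq μ f f₀ < ∞) :
    MemLp (fun x => f x / f₀ x - 1) 2 (densityMeasure μ f₀) := by
  refine ⟨((hf.measurable.div hf₀.measurable).sub_const 1).aestronglyMeasurable, ?_⟩
  by_contra hcon
  rw [chiSq, not_lt_top_iff.1 hcon] at h
  simp at h

theorem integral_div_sub_one_sq (hf : IsDensity μ f) (hf₀ : IsDensity μ f₀)
    (h : chiSq μ f f₀ < ∞) :
    ∫ x, (f x / f₀ x - 1) ^ 2 ∂densityMeasure μ f₀ = chi μ f f₀ ^ 2 := by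
  have h0 : 0 ≤ ∫ x, (f x / f₀ x - 1) ^ 2 ∂densityMeasure μ f₀ :=
    integral_nonneg fun _ => sq_nonneg _
  rw [chi_sq, chiSq, (memLp_div_sub_one hf hf₀ h).eLpNorm_eq_integral_rpow_norm two_ne_zero
    ENNReal.ofNat_ne_top]
  simp only [ENNReal.toReal_ofNat, Real.rpow_ofNat, Real.norm_eq_abs, sq_abs]
  rw [← ENNReal.ofReal_pow (by positivity), ← Real.rpow_natCast, ← Real.rpow_mul h0]
  norm_num [ENNReal.toReal_ofReal h0]

theorem score_ae_eq (hf₀ : IsDensity μ f₀) :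
    score μ f₀ f =ᵐ[densityMeasure μ f₀] fun x => (f x / f₀ x - 1) / chi μ f f₀ := by
  filter_upwards [hf₀.ae_pos] with x hx
  simp [score, hx.ne']

theorem integral_score_nonpos (hf : IsDensity μ f) (hf₀ : IsDensity μ f₀)
    (h : chiSq μ f f₀ < ∞) : ∫ x, score μ f₀ f x ∂densityMeasure μ f₀ ≤ 0 := by
  have := hf₀.isProbabilityMeasure
  have hi : Integrable (fun x => f x / f₀ x) (densityMeasure μ f₀) := by
    have h1 := ((memLp_div_sub_one hf hf₀ h).integrable (by norm_num)).add
      (integrable_const (1 : ℝ))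
    exact h1.congr (ae_of_all _ fun x => sub_add_cancel _ _)
  have h1 : ∫ x, f x / f₀ x ∂densityMeasure μ f₀ ≤ 1 := by
    rw [integral_eq_lintegral_of_nonneg_ae
      (ae_of_all _ fun x => div_nonneg (hf.nonneg x) (hf₀.nonneg x)) hi.aestronglyMeasurable]
    exact ENNReal.toReal_le_of_le_ofReal zero_le_one (by simpa using hf.lintegral_div_le hf₀)
  rw [integral_congr_ae (score_ae_eq hf₀), integral_div, integral_sub hi (integrable_const 1)]
  simp only [integral_const, probReal_univ, smul_eq_mul, mul_one]
  exact div_nonpos_of_nonpos_of_nonneg (by linarith) (Real.sqrt_nonneg _)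

theorem integral_score_sq (hf : IsDensity μ f) (hf₀ : IsDensity μ f₀)
    (h0 : 0 < chiSq μ f f₀) (h : chiSq μ f f₀ < ∞) :
    ∫ x, score μ f₀ f x ^ 2 ∂densityMeasure μ f₀ = 1 := by
  have h1 : (fun x => score μ f₀ f x ^ 2) =ᵐ[densityMeasure μ f₀]
      fun x => (f x / f₀ x - 1) ^ 2 / chi μ f f₀ ^ 2 := by
    filter_upwards [score_ae_eq (f := f) hf₀] with x hx
    rw [hx, div_pow]
  rw [integral_congr_ae h1, integral_div, integral_div_sub_one_sq hf hf₀ h,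
    div_self (pow_ne_zero 2 (chi_pos h0 h).ne')]

end Score

/-! ### The likelihood inequality -/

theorem logLik_eq_coe {𝓧 : Type*} {n : ℕ} {x : ℕ → 𝓧} {f : 𝓧 → ℝ}
    (h : ∀ i ∈ Finset.range n, 0 < f (x i)) :
    logLik n x f = ((∑ i ∈ Finset.range n, Real.log (f (x i)) : ℝ) : EReal) := by
  have h1 : ∀ I : Finset ℕ, ((∑ i ∈ I, Real.log (f (x i)) : ℝ) : EReal) =
      ∑ i ∈ I, (Real.log (f (x i)) : EReal) := fun I => by
    classical
    induction I using Finset.induction_on with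
    | empty => simp
    | insert i I hi ih => rw [Finset.sum_insert hi, Finset.sum_insert hi, EReal.coe_add, ih]
  rw [logLik, h1]
  exact Finset.sum_congr rfl fun i hi => ENNReal.log_ofReal_of_pos (h i hi)

theorem pos_of_logLik_ne_bot {𝓧 : Type*} {n : ℕ} {x : ℕ → 𝓧} {f : 𝓧 → ℝ} (h : logLik n x f ≠ ⊥) :
    ∀ i ∈ Finset.range n, 0 < f (x i) := by
  intro i hi
  by_contra hcon
  refine h ?_
  rw [logLik, ← Finset.add_sum_erase _ _ hi, ENNReal.log_ofReal, if_pos (not_lt.1 hcon),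
    EReal.bot_add]

/-- For `t ≥ 0` the quadratic term vanishes; for `t ≤ 0` it comes from the power series of the
logarithm, all of whose terms are then nonpositive. -/
theorem log_one_add_le {t : ℝ} (ht : -1 < t) : Real.log (1 + t) ≤ t - max (-t) 0 ^ 2 / 2 := by
  rcases le_total 0 t with h | h
  · rw [max_eq_right (by linarith)]
    have := Real.log_le_sub_one_of_pos (show 0 < 1 + t by linarith)
    linarith
  · rw [max_eq_left (by linarith)]
    have h1 := Real.hasSum_pow_div_log_of_abs_lt_one (x := -t)
      (by rw [abs_lt]; constructor <;> linarith)
    have h2 := sum_le_hasSum (Finset.range 2) (fun i _ => by positivity [neg_nonneg.2 h]) h1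
    norm_num [Finset.sum_range_succ] at h2 ⊢
    linarith

/-- The deterministic core of the argument, on the event that the empirical process is bounded by
`M` and the empirical means of the negative parts of the scores are at least `b`. -/
theorem natCast_mul_chi_sq_le {μ : Measure 𝓧} {f f₀ : 𝓧 → ℝ} {n : ℕ} {x : ℕ → 𝓧} {c M b : ℝ}
    (hpos : ∀ i, 0 < f₀ (x i)) (hχ : 0 < chi μ f f₀)
    (hl : logLik n x f₀ - (c : EReal) ≤ logLik n x f)
    (hM : empiricalProcess (densityMeasure μ f₀) n x (score μ f₀ f) ≤ M)
    (hmean : ∫ y, score μ f₀ f y ∂densityMeasure μ f₀ ≤ 0) (hb : 0 < b)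
    (hneg : b ≤ empiricalMean n x (fun y => max (-score μ f₀ f y) 0)) :
    n * chi μ f f₀ ^ 2 ≤ 4 * (M ^ 2 / b ^ 2 + c) / b ^ 2 := by
  set χ := chi μ f f₀
  set s := score μ f₀ f
  rcases Nat.eq_zero_or_pos n with rfl | hn
  · simp [empiricalMean] at hneg
    linarith
  have hn0 : (0 : ℝ) < n := by exact_mod_cast hn
  have hl0 := logLik_eq_coe (n := n) (x := x) (f := f₀) fun i _ => hpos i
  -- `f` cannot vanish at a sample point, as its log-likelihood would be `-∞`
  have hbot : logLik n x f ≠ ⊥ := fun h => by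
    rw [h, hl0, ← EReal.coe_sub, le_bot_iff] at hl
    exact EReal.coe_ne_bot _ hl
  have hfpos := pos_of_logLik_ne_bot hbot
  rw [hl0, logLik_eq_coe hfpos, ← EReal.coe_sub, EReal.coe_le_coe_iff] at hl
  have hs : ∀ i, f (x i) / f₀ (x i) = 1 + χ * s (x i) := fun i => by
    simp only [s, score, (hpos i).ne', if_false]
    rw [mul_div_cancel₀ _ hχ.ne']; ring
  have hlog : ∀ i ∈ Finset.range n, Real.log (f (x i)) - Real.log (f₀ (x i)) ≤
      χ * s (x i) - χ ^ 2 / 2 * max (-s (x i)) 0 ^ 2 := fun i hi => by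
    have h1 : 0 < 1 + χ * s (x i) := by rw [← hs]; exact div_pos (hfpos i hi) (hpos i)
    rw [← Real.log_div (hfpos i hi).ne' (hpos i).ne', hs]
    refine (log_one_add_le (by linarith)).trans_eq ?_
    rw [← mul_neg, ← mul_zero χ, ← mul_max_of_nonneg _ _ hχ.le, mul_zero]; ring
  have hsum := Finset.sum_le_sum hlog
  rw [Finset.sum_sub_distrib, Finset.sum_sub_distrib, ← Finset.mul_sum, ← Finset.mul_sum] at hsum
  -- the linear term, where the nonpositive mean of the score is dropped
  have hlin : ∑ i ∈ Finset.range n, s (x i) ≤ √(n : ℝ) * M := by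
    have h1 : √(n : ℝ) * empiricalProcess (densityMeasure μ f₀) n x s =
        ∑ i ∈ Finset.range n, s (x i) - n * ∫ y, s y ∂densityMeasure μ f₀ := by
      rw [empiricalProcess, ← mul_assoc, Real.mul_self_sqrt hn0.le]
      field_simp
    have h2 := mul_le_mul_of_nonneg_left hM (Real.sqrt_nonneg (n : ℝ))
    nlinarith
  -- the quadratic term, by the Cauchy–Schwarz inequality
  have hquad : n * b ^ 2 ≤ ∑ i ∈ Finset.range n, max (-s (x i)) 0 ^ 2 := by
    have h1 := sq_sum_le_card_mul_sum_sq (s := Finset.range n) (f := fun i => max (-s (x i)) 0)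
    rw [Finset.card_range] at h1
    have h2 : n * b ≤ ∑ i ∈ Finset.range n, max (-s (x i)) 0 := by
      rw [empiricalMean, inv_mul_eq_div, le_div_iff₀ hn0] at hneg
      linarith
    have h3 := pow_le_pow_left₀ (by positivity) h2 2
    refine le_of_mul_le_mul_left ?_ hn0
    nlinarith
  set D := √(n : ℝ) * χ with hD
  have hD2 : n * χ ^ 2 = D ^ 2 := by rw [hD, mul_pow, Real.sq_sqrt hn0.le]
  have h1 : D ^ 2 * b ^ 2 / 2 ≤ D * M + c := by
    have h2 := mul_le_mul_of_nonneg_left hlin hχ.le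
    have h3 := mul_le_mul_of_nonneg_left hquad (by positivity : 0 ≤ χ ^ 2 / 2)
    rw [← hD2, hD]
    nlinarith
  -- absorb the linear term into half of the quadratic one
  have h4 : D * M ≤ D ^ 2 * b ^ 2 / 4 + M ^ 2 / b ^ 2 := by
    have h5 : D ^ 2 * b ^ 2 / 4 + M ^ 2 / b ^ 2 - D * M = (D * b / 2 - M / b) ^ 2 := by
      field_simp; ring
    linarith [sq_nonneg (D * b / 2 - M / b)]
  rw [hD2, le_div_iff₀ (by positivity)]
  linarith

end

/-! ### The rate of convergence -/

theorem lemma1 {𝓧 : Type*} [MeasurableSpace 𝓧] (μ : Measure 𝓧)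
    (𝓕 : Set (𝓧 → ℝ)) (h𝓕 : ∀ f ∈ 𝓕, IsDensity μ f)
    (f₀ : 𝓧 → ℝ) (hf₀ : f₀ ∈ 𝓕)
    -- every other member of the class has positive, finite chi-square divergence from `f₀`
    (hA1 : ∀ f ∈ 𝓕 \ {f₀}, 0 < chiSq μ f f₀ ∧ chiSq μ f f₀ < ∞)
    -- the score set is Donsker, with a square-integrable envelope
    (hA2 : IsDonsker (densityMeasure μ f₀) (scoreSet μ 𝓕 f₀) ∧
      HasSquareIntegrableEnvelope (densityMeasure μ f₀) (scoreSet μ 𝓕 f₀))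
    -- an i.i.d. sample from `f₀`
    {Ω : Type*} [MeasurableSpace Ω] (Pr : Measure Ω) [IsProbabilityMeasure Pr]
    (X : ℕ → Ω → 𝓧) (hX : ∀ i, Measurable (X i)) (hindep : iIndepFun X Pr)
    (hlaw : ∀ i, Pr.map (X i) = densityMeasure μ f₀)
    -- a nonnegative, possibly random tolerance that is bounded in probability
    (c : ℕ → Ω → ℝ) (hc : ∀ n ω, 0 ≤ c n ω)
    (hcO : IsBoundedInProbability Pr fun n ω => ENNReal.ofReal (c n ω)) :
    IsBoundedInProbability Pr fun n ω =>
      ⨆ f ∈ approxMLESet 𝓕 f₀ n (fun i => X i ω) (c n ω), (n : ℝ≥0∞) * chiSq μ f f₀ := by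
  set P := densityMeasure μ f₀ with hP
  set 𝓢 := scoreSet μ 𝓕 f₀ with h𝓢
  have hd₀ := h𝓕 f₀ hf₀
  have := hd₀.isProbabilityMeasure
  obtain ⟨hS, F, hF, hSF⟩ := hA2
  have h0 : ∀ s ∈ 𝓢, ∫ y, s y ∂P ≤ 0 := by
    rintro _ ⟨f, hf, rfl⟩
    exact integral_score_nonpos (h𝓕 f hf.1) hd₀ (hA1 f hf).2
  have h1 : ∀ s ∈ 𝓢, ∫ y, s y ^ 2 ∂P = 1 := by
    rintro _ ⟨f, hf, rfl⟩
    exact integral_score_sq (h𝓕 f hf.1) hd₀ (hA1 f hf).1 (hA1 f hf).2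
  obtain ⟨b, hb, hbS⟩ := hS.exists_le_empiricalMean_negPart hF hSF h0 h1
  have hmap : Pr.map (fun ω i => X i ω) = Measure.infinitePi fun _ : ℕ => P := by
    rw [hindep.map_fun_eq_infinitePi_map hX]
    simp_rw [hlaw]
  have htrans : ∀ B : Set (ℕ → 𝓧), Pr ((fun ω i => X i ω) ⁻¹' B) ≤
      Measure.infinitePi (fun _ : ℕ => P) B := fun B => by
    rw [← hmap]
    exact Measure.le_map_apply (measurable_pi_lambda _ hX).aemeasurable B
  have hnull : Pr {ω | ¬∀ i, 0 < f₀ (X i ω)} = 0 := by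
    rw [← ae_iff, ae_all_iff]
    exact fun i => ae_of_ae_map (hX i).aemeasurable (by rw [hlaw i]; exact hd₀.ae_pos)
  intro ε hε
  obtain ⟨η, hη0, hηε⟩ := ENNReal.lt_iff_exists_nnreal_btwn.1
    (ENNReal.div_pos hε.ne' (by norm_num : (3 : ℝ≥0∞) ≠ ∞))
  have hη : (0 : ℝ) < η := by exact_mod_cast hη0
  obtain ⟨C, hC⟩ := hcO η hη0
  obtain ⟨M, hM0, hM⟩ := hS.exists_abs_empiricalProcess_le hη
  refine ⟨(4 * (M ^ 2 / b ^ 2 + C) / b ^ 2).toNNReal, ?_⟩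
  filter_upwards [hC, hM, hbS η hη] with n hCn ⟨B₁, _, hB₁, hB₁M⟩ ⟨B₂, hB₂, hB₂b⟩
  rw [ENNReal.ofReal_coe_nnreal] at hB₁ hB₂
  -- off three events of probability at most `η` and a null set, the deterministic bound applies
  have hsub : {ω | (((4 * (M ^ 2 / b ^ 2 + C) / b ^ 2).toNNReal : ℝ≥0) : ℝ≥0∞) <
        ⨆ f ∈ approxMLESet 𝓕 f₀ n (fun i => X i ω) (c n ω), (n : ℝ≥0∞) * chiSq μ f f₀} ⊆
      ({ω | (C : ℝ≥0∞) < ENNReal.ofReal (c n ω)} ∪ (fun ω i => X i ω) ⁻¹' B₁ ∪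
        (fun ω i => X i ω) ⁻¹' B₂) ∪ {ω | ¬∀ i, 0 < f₀ (X i ω)} := by
    intro ω hω
    rw [Set.mem_ofPred_eq] at hω
    by_contra hcon
    simp only [Set.mem_union, Set.mem_ofPred_eq, Set.mem_preimage, not_or, not_lt, not_not]
      at hcon
    obtain ⟨⟨⟨hcC, hω₁⟩, hω₂⟩, hωpos⟩ := hcon
    have hcC' : c n ω ≤ C := by
      rw [← ENNReal.ofReal_coe_nnreal] at hcC
      exact (ENNReal.ofReal_le_ofReal_iff C.2).1 hcC
    refine absurd hω (not_lt.2 (iSup₂_le fun f hf => ?_))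
    by_cases hff₀ : f = f₀
    · rw [hff₀, chiSq_self hd₀, mul_zero]
      exact zero_le
    have hf𝓕 : f ∈ 𝓕 \ {f₀} := ⟨hf.1, hff₀⟩
    obtain ⟨hχ0, hχ1⟩ := hA1 f hf𝓕
    have hs : score μ f₀ f ∈ 𝓢 := ⟨f, hf𝓕, rfl⟩
    have hkey := natCast_mul_chi_sq_le hωpos (chi_pos hχ0 hχ1) hf.2
      ((le_abs_self _).trans (hB₁M _ hω₁ _ hs)) (h0 _ hs) hb (hB₂b _ hω₂ _ hs)
    have hle : n * chi μ f f₀ ^ 2 ≤ 4 * (M ^ 2 / b ^ 2 + C) / b ^ 2 := hkey.trans (by gcongr)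
    rw [chi_sq] at hle
    have h2 := ENNReal.ofReal_le_ofReal hle
    rwa [ENNReal.ofReal_mul n.cast_nonneg, ENNReal.ofReal_natCast,
      ENNReal.ofReal_toReal hχ1.ne] at h2
  calc _ ≤ _ := measure_mono hsub
    _ ≤ (η + η + η) + 0 := by
      refine (measure_union_le _ _).trans (add_le_add ((measure_union_le _ _).trans
        (add_le_add ((measure_union_le _ _).trans (add_le_add hCn ?_)) ?_)) hnull.le)
      · exact (htrans B₁).trans hB₁
      · exact (htrans B₂).trans hB₂
    _ ≤ ε / 3 + ε / 3 + ε / 3 + 0 := by gcongr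
    _ = ε := by rw [add_zero, ENNReal.add_thirds]
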